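/- Let $\Omega$ be an extremally disconnected compact Hausdorff space, let $X$ be a real or complex Banach space, and let $\mathrm{WC}(\Omega,X)$ be the space of functions $f:\Omega\to X$ that are continuous for the weak topology of $X$, with the supremum norm. For a Banach space $E$, a point $x^*$ of the closed unit ball $E_1^*$ of $E^*$ is called a w$^*$-w point of continuity (w$^*$-w PC) if the identity map $(E_1^*,\mathrm{w}^*)\to(E_1^*,\mathrm{w})$ is continuous at $x^*$. For $\omega\in\Omega$ and $x^*\in X^*$ let $(\delta_\omega\otimes x^*)(f)=x^*(f(\omega))$ for $f\in \mathrm{WC}(\Omega,X)$. Let $N$ be a finite or countably infinite index set, let $\alpha_i\in(0,1]$ for $i\in N$ with $\sum_{i\in N}\alpha_i=1$, let $\omega_i$ $(i\in N)$ be pairwise distinct isolated points of $\Omega$, and let $x_i^*\in X_1^*$ be a w$^*$-w PC for each $i\in N$; if $X$ is reflexive, assume moreover that $\|x_i^*\|=1$ for every $i\in N$. Let $$\Lambda=\sum_{i\in N}\alpha_i\,\delta_{\omega_i}\otimes x_i^*\in \mathrm{WC}(\Omega,X)_1^*,$$ the series converging in norm. Then $\Lambda$ is a w$^*$-w PC of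 $\mathrm{WC}(\Omega,X)_1^*$. -/

import Mathlib

open scoped ENNReal

/-- The Banach space `X` is reflexive: the canonical embedding into the bidual is onto. -/
def IsReflexiveSpace (𝕜 X : Type*) [RCLike 𝕜] [NormedAddCommGroup X] [NormedSpace 𝕜 X] : Prop :=
  Function.Surjective (NormedSpace.inclusionInDoubleDual 𝕜 X)

/-- `x` lies in the closed unit ball of the dual of `E`, and the identity map from this ball with
the weak-star topology to this ball with the weak topology (the one induced by the bidual of `E`)
is continuous at `x`. -/
def IsWeakStarWeakPC {𝕜 E : Type*} [RCLike 𝕜] [NormedAddCommGroup E] [NormedSpace 𝕜 E]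
    (x : StrongDual 𝕜 E) : Prop :=
  ‖x‖ ≤ 1 ∧
    ContinuousWithinAt
      (fun y : WeakDual 𝕜 E => toWeakSpace 𝕜 (StrongDual 𝕜 E) (WeakDual.toStrongDual y))
      {y : WeakDual 𝕜 E | ‖WeakDual.toStrongDual y‖ ≤ 1}
      (StrongDual.toWeakDual x)

/-- The space of functions `Ω → X` that are continuous for the weak topology of `X`, with the
supremum norm, as a subspace of the space of all bounded functions. For compact `Ω` the
boundedness is automatic, see `WC.exists_of_continuous`. -/
def WC (𝕜 Ω X : Type*) [RCLike 𝕜] [TopologicalSpace Ω] [NormedAddCommGroup X] [NormedSpace 𝕜 X] :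
    Submodule 𝕜 (lp (fun _ : Ω => X) ∞) where
  carrier := {f | Continuous fun ω => toWeakSpace 𝕜 X (f ω)}
  add_mem' {f g} hf hg := by
    have h : Continuous fun ω => toWeakSpace 𝕜 X (f ω) + toWeakSpace 𝕜 X (g ω) := hf.add hg
    exact h
  zero_mem' := by
    have h : Continuous fun _ : Ω => (0 : WeakSpace 𝕜 X) := continuous_const
    exact h
  smul_mem' c f hf := by
    have h : Continuous fun ω => c • toWeakSpace 𝕜 X (f ω) := hf.const_smul c
    exact h

/-- Every weakly continuous function on a compact space is an element of `WC`. -/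
theorem WC.exists_of_continuous {𝕜 Ω X : Type*} [RCLike 𝕜] [TopologicalSpace Ω] [CompactSpace Ω]
    [NormedAddCommGroup X] [NormedSpace 𝕜 X] (f : Ω → X)
    (hf : Continuous fun ω => toWeakSpace 𝕜 X (f ω)) :
    ∃ F : WC 𝕜 Ω X, ∀ ω, (F : lp (fun _ : Ω => X) ∞) ω = f ω := by
  have hb : ∃ C, ∀ ω, ‖NormedSpace.inclusionInDoubleDual 𝕜 X (f ω)‖ ≤ C := by
    apply banach_steinhaus
    intro φ
    have hc : Continuous fun ω => φ (f ω) :=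
      (WeakBilin.eval_continuous (topDualPairing 𝕜 X).flip φ).comp hf
    obtain ⟨C, hC⟩ := (isCompact_range hc.norm).bddAbove
    exact ⟨C, fun ω => hC ⟨ω, rfl⟩⟩
  obtain ⟨C, hC⟩ := hb
  have hm : Memℓp f ∞ := by
    apply memℓp_infty
    refine ⟨C, ?_⟩
    rintro _ ⟨ω, rfl⟩
    have h := hC ω
    rwa [show ‖NormedSpace.inclusionInDoubleDual 𝕜 X (f ω)‖ = ‖f ω‖ from
      (NormedSpace.inclusionInDoubleDualLi 𝕜 (E := X)).norm_map (f ω)] at h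
  exact ⟨⟨⟨f, hm⟩, hf⟩, fun _ => rfl⟩

/-- The functional `δ_ω ⊗ φ` on `WC 𝕜 Ω X`, that is, `f ↦ φ (f ω)`. -/
noncomputable def deltaTensor {𝕜 Ω X : Type*} [RCLike 𝕜] [TopologicalSpace Ω]
    [NormedAddCommGroup X] [NormedSpace 𝕜 X] (ω : Ω) (φ : StrongDual 𝕜 X) :
    StrongDual 𝕜 (WC 𝕜 Ω X) :=
  φ.comp ((lp.evalCLM 𝕜 (fun _ : Ω => X) ∞ ω).comp (WC 𝕜 Ω X).subtypeL)

/-- The defining formula of `δ_ω ⊗ φ`. -/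
theorem deltaTensor_apply {𝕜 Ω X : Type*} [RCLike 𝕜] [TopologicalSpace Ω]
    [NormedAddCommGroup X] [NormedSpace 𝕜 X] (ω : Ω) (φ : StrongDual 𝕜 X) (f : WC 𝕜 Ω X) :
    deltaTensor ω φ f = φ ((f : lp (fun _ : Ω => X) ∞) ω) := rfl

/-!
Write `L_ω` for the functional `f ↦ L (χ_ω f)`, where `χ_ω` is the indicator of the isolated point
`ω`. Multiplication by `χ_ω` is an M-projection of `WC 𝕜 Ω X`, so its adjoint `L ↦ L_ω` is an
L-projection of the dual: the norms of the `L_{ω_i}`, `i ∈ s`, and of `L - ∑ i ∈ s, L_{ω_i}` add up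
to `‖L‖`. When `L` tends weak-star to `Λ` in the unit ball, lower semicontinuity gives
`liminf ‖L_{ω_i}‖ ≥ α i`, and `∑ α i = 1` leaves no room for more. Hence `‖L_{ω_i}‖` tends to `α i`,
and the partial sums `∑ i ∈ s, L_{ω_i}` approximate `L` uniformly in `L` near `Λ`. It then suffices
to treat each `L_{ω_i}`, whose normalization tends weak-star to the functional of norm one
`δ_{ω_i} ⊗ x i`; this is a point of continuity because `x i` is one.

That `x i` has norm one is automatic when `X` is not reflexive: continuity at an interior point of
the ball passes to `0` by translation and scaling, and a functional on the dual that is weak-star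
continuous on the ball at `0` is a norm limit of evaluations at points of `X`.
-/

open Filter Topology

section Projections

theorem sum_norm_add_norm_sub_sum_of_isLprojection {X M ι : Type*} [NormedAddCommGroup X] [Ring M]
    [Module M X] {P : ι → M} (hP : ∀ i, IsLprojection X (P i))
    (hPP : Pairwise fun i j => P i * P j = 0) (s : Finset ι) (x : X) :
    ∑ i ∈ s, ‖P i • x‖ + ‖x - ∑ i ∈ s, P i • x‖ = ‖x‖ := by
  classical
  induction s using Finset.induction_on with
  | empty => simp
  | insert j s hj ih =>
    have hzero : ∑ i ∈ s, P j • P i • x = 0 := Finset.sum_eq_zero fun i hi => by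
      rw [smul_smul, hPP (ne_of_mem_of_not_mem hi hj).symm, zero_smul]
    have hsplit := (hP j).Lnorm (x - ∑ i ∈ s, P i • x)
    rw [sub_smul, one_smul, smul_sub, Finset.smul_sum, hzero, sub_zero, sub_right_comm,
      sub_sub] at hsplit
    rw [Finset.sum_insert hj, Finset.sum_insert hj]
    linarith

variable {𝕜 E : Type*} [RCLike 𝕜] [NormedAddCommGroup E] [NormedSpace 𝕜 E]

theorem isLprojection_precomp {P : E →L[𝕜] E} (hP : IsMprojection E P) :
    IsLprojection (StrongDual 𝕜 E) (P.precomp 𝕜 : StrongDual 𝕜 E →L[𝕜] StrongDual 𝕜 E) := by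
  have hidem : ∀ f, P (P f) = P f := fun f => congr($hP.proj.eq f)
  refine ⟨ContinuousLinearMap.ext fun L => ContinuousLinearMap.ext fun f => congr(L $(hidem f)),
    fun L => le_antisymm ?_ (add_le_of_forall_lt fun a ha b hb => ?_)⟩
  · calc ‖L‖ = ‖L ∘L P + (L - L ∘L P)‖ := by rw [add_sub_cancel]
      _ ≤ ‖L ∘L P‖ + ‖L - L ∘L P‖ := norm_add_le _ _
  obtain ⟨e, he, hae⟩ := (L ∘L P).exists_lt_apply_of_lt_opNorm ha
  obtain ⟨f, hf, hbf⟩ := (L - L ∘L P).exists_lt_apply_of_lt_opNorm hb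
  obtain ⟨s, hs, hse⟩ := RCLike.exists_norm_eq_mul_self ((L ∘L P) e)
  obtain ⟨t, ht, htf⟩ := RCLike.exists_norm_eq_mul_self ((L - L ∘L P) f)
  -- The two nearly norming vectors combine, since `P` sees only `e` and `1 - P` only `f`.
  let g : E := s • P e + t • (f - P f)
  have hPg : P g = s • P e := by simp [g, hidem]
  have hg : ‖g‖ ≤ 1 := by
    have hPe : ‖P e‖ ≤ ‖e‖ := (le_max_left _ _).trans_eq (hP.Mnorm e).symm
    have hPf : ‖f - P f‖ ≤ ‖f‖ := (le_max_right _ _).trans_eq (hP.Mnorm f).symm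
    calc ‖g‖ = max ‖P g‖ ‖g - P g‖ := hP.Mnorm g
      _ = max ‖P e‖ ‖f - P f‖ := by simp [hPg, g, norm_smul, hs, ht]
      _ ≤ 1 := max_le (hPe.trans he.le) (hPf.trans hf.le)
  have hLg : L g = ((‖(L ∘L P) e‖ + ‖(L - L ∘L P) f‖ : ℝ) : 𝕜) := by
    rw [RCLike.ofReal_add, hse, htf]
    simp [g]
  have hle := L.unit_le_opNorm g hg
  rw [hLg, RCLike.norm_of_nonneg (by positivity)] at hle
  exact (add_lt_add hae hbf).le.trans hle

theorem sum_norm_comp_add_norm_sub_sum_comp {ι : Type*} {P : ι → E →L[𝕜] E}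
    (hP : ∀ i, IsMprojection E (P i)) (hPP : Pairwise fun i j => P i ∘L P j = 0) (s : Finset ι)
    (L : StrongDual 𝕜 E) :
    ∑ i ∈ s, ‖L ∘L P i‖ + ‖L - ∑ i ∈ s, L ∘L P i‖ = ‖L‖ := by
  refine sum_norm_add_norm_sub_sum_of_isLprojection (fun i => isLprojection_precomp (hP i))
    (fun i j hij => ContinuousLinearMap.ext fun K => ?_) s L
  change (K ∘L P j) ∘L P i = 0
  rw [ContinuousLinearMap.comp_assoc, hPP hij.symm, ContinuousLinearMap.comp_zero]

end Projections

theorem tendsto_of_eventually_lt_of_sum_le {ι A : Type*} {l : Filter A} {f : ι → A → ℝ}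
    {α : ι → ℝ} {c : ℝ} (hα : HasSum α c) (hlow : ∀ i, ∀ b < α i, ∀ᶠ a in l, b < f i a)
    (hup : ∀ᶠ a in l, ∀ s : Finset ι, ∑ i ∈ s, f i a ≤ c) (i : ι) :
    Tendsto (f i) l (𝓝 (α i)) := by
  classical
  refine tendsto_order.2 ⟨hlow i, fun b hb => ?_⟩
  have hlarge : ∀ᶠ s in atTop, c - (b - α i) < ∑ j ∈ s, α j :=
    hα.eventually_const_lt (by linarith)
  obtain ⟨s, hs, his⟩ := (hlarge.and (eventually_ge_atTop {i})).exists
  have hi : i ∈ s := his (Finset.mem_singleton_self i)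
  have hmin : ∀ j, Tendsto (fun a => min (f j a) (α j)) l (𝓝 (α j)) := fun j =>
    tendsto_order.2 ⟨fun d hd => (hlow j d hd).mono fun a ha => lt_min ha hd,
      fun d hd => Eventually.of_forall fun a => (min_le_right _ _).trans_lt hd⟩
  have hrest : c - b < ∑ j ∈ s.erase i, α j := by
    linarith [Finset.add_sum_erase s α hi]
  filter_upwards [hup, (tendsto_finsetSum (s.erase i) fun j _ => hmin j).eventually_const_lt hrest]
    with a hsum hmina
  have hmin_le : ∑ j ∈ s.erase i, min (f j a) (α j) ≤ ∑ j ∈ s.erase i, f j a :=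
    Finset.sum_le_sum fun j _ => min_le_left _ _
  linarith [hsum s, Finset.add_sum_erase s (fun j => f j a) hi]

section PointsOfContinuity

variable {𝕜 E : Type*} [RCLike 𝕜] [NormedAddCommGroup E] [NormedSpace 𝕜 E]

/-- The filter of weak-star neighbourhoods of `x` in the closed unit ball of the dual of `E`. It is
a filter on `StrongDual 𝕜 E` rather than on `WeakDual 𝕜 E`, so that elements of the bidual act on it
without coercions. -/
noncomputable def dualBallNhds (x : StrongDual 𝕜 E) : Filter (StrongDual 𝕜 E) :=
  (𝓝[{y | ‖WeakDual.toStrongDual y‖ ≤ 1}] StrongDual.toWeakDual x).comap StrongDual.toWeakDual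

theorem tendsto_dualBallNhds_iff {A : Type*} {l : Filter A} {u : A → StrongDual 𝕜 E}
    {x : StrongDual 𝕜 E} :
    Tendsto u l (dualBallNhds x) ↔
      (∀ᶠ a in l, ‖u a‖ ≤ 1) ∧ ∀ e, Tendsto (fun a => u a e) l (𝓝 (x e)) := by
  rw [dualBallNhds, tendsto_comap_iff, tendsto_nhdsWithin_iff, and_comm]
  exact and_congr Iff.rfl tendsto_iff_forall_eval_tendsto_topDualPairing

theorem eventually_dualBallNhds_norm_le_one (x : StrongDual 𝕜 E) :
    ∀ᶠ y in dualBallNhds x, ‖y‖ ≤ 1 :=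
  (tendsto_dualBallNhds_iff.1 tendsto_id).1

theorem tendsto_apply_dualBallNhds (x : StrongDual 𝕜 E) (e : E) :
    Tendsto (fun y : StrongDual 𝕜 E => y e) (dualBallNhds x) (𝓝 (x e)) :=
  (tendsto_dualBallNhds_iff.1 tendsto_id).2 e

theorem isWeakStarWeakPC_iff {x : StrongDual 𝕜 E} :
    IsWeakStarWeakPC x ↔
      ‖x‖ ≤ 1 ∧ ∀ Φ : StrongDual 𝕜 (StrongDual 𝕜 E), Tendsto Φ (dualBallNhds x) (𝓝 (Φ x)) := by
  have hinj : Function.Injective (topDualPairing 𝕜 (StrongDual 𝕜 E)).flip := fun a b hab =>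
    (SeparatingDual.eq_iff_forall_dual_eq (R := 𝕜)).2 fun Φ => congr($hab Φ)
  have hcomap : dualBallNhds x = (𝓝[{y | ‖WeakDual.toStrongDual y‖ ≤ 1}]
      StrongDual.toWeakDual x).map WeakDual.toStrongDual :=
    (map_equiv_symm (StrongDual.toWeakDual (𝕜 := 𝕜) (E := E)).toEquiv _).symm
  rw [hcomap]
  exact and_congr Iff.rfl (WeakBilin.tendsto_iff_forall_eval_tendsto _ hinj)

theorem IsWeakStarWeakPC.tendsto_apply {x : StrongDual 𝕜 E} (hx : IsWeakStarWeakPC x) {A : Type*}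
    {l : Filter A} {u : A → StrongDual 𝕜 E} (hu : Tendsto u l (dualBallNhds x))
    (Φ : StrongDual 𝕜 (StrongDual 𝕜 E)) : Tendsto (fun a => Φ (u a)) l (𝓝 (Φ x)) :=
  ((isWeakStarWeakPC_iff.1 hx).2 Φ).comp hu

theorem eventually_lt_norm_of_tendsto_apply {A : Type*} {l : Filter A} {u : A → StrongDual 𝕜 E}
    {x : StrongDual 𝕜 E} (hu : ∀ e, Tendsto (fun a => u a e) l (𝓝 (x e))) {c : ℝ}
    (hc : c < ‖x‖) : ∀ᶠ a in l, c < ‖u a‖ := by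
  obtain ⟨e, he, hce⟩ := x.exists_lt_apply_of_lt_opNorm hc
  filter_upwards [(hu e).norm.eventually_const_lt hce] with a ha
  exact ha.trans_le ((u a).unit_le_opNorm e he.le)

theorem IsWeakStarWeakPC.tendsto_apply_of_tendsto_norm {x : StrongDual 𝕜 E}
    (hx : IsWeakStarWeakPC x) {c : ℝ} (hc : 0 < c) {A : Type*} {l : Filter A}
    {u : A → StrongDual 𝕜 E} (hnorm : Tendsto (fun a => ‖u a‖) l (𝓝 c))
    (hu : ∀ e, Tendsto (fun a => u a e) l (𝓝 (((c : 𝕜) • x) e)))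
    (Φ : StrongDual 𝕜 (StrongDual 𝕜 E)) :
    Tendsto (fun a => Φ (u a)) l (𝓝 (Φ ((c : 𝕜) • x))) := by
  have hc𝕜 : (c : 𝕜) ≠ 0 := RCLike.ofReal_ne_zero.2 hc.ne'
  have hnorm𝕜 : Tendsto (fun a => (‖u a‖ : 𝕜)) l (𝓝 (c : 𝕜)) :=
    (RCLike.continuous_ofReal.tendsto c).comp hnorm
  have hunit : Tendsto (fun a => (‖u a‖ : 𝕜)⁻¹ • u a) l (dualBallNhds x) := by
    refine tendsto_dualBallNhds_iff.2 ⟨Eventually.of_forall fun a => ?_, fun e => ?_⟩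
    · rw [norm_smul, norm_inv, RCLike.norm_ofReal, abs_norm]
      exact inv_mul_le_one
    · simpa [hc𝕜] using (hnorm𝕜.inv₀ hc𝕜).mul (hu e)
  rw [map_smul]
  refine (hnorm𝕜.smul (hx.tendsto_apply hunit Φ)).congr' ?_
  filter_upwards [hnorm.eventually_ne hc.ne'] with a ha
  rw [← map_smul, smul_inv_smul₀ (RCLike.ofReal_ne_zero.2 ha)]

end PointsOfContinuity

section Nonreflexive

variable {𝕜 E : Type*} [RCLike 𝕜] [NormedAddCommGroup E] [NormedSpace 𝕜 E]

theorem exists_mem_span_norm_sub_le {ι : Type*} [Finite ι] (L : ι → StrongDual 𝕜 E)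
    {Φ : StrongDual 𝕜 E} {ε : ℝ} (hε : 0 ≤ ε)
    (hΦ : ∀ e, ‖e‖ ≤ 1 → (∀ i, L i e = 0) → ‖Φ e‖ ≤ ε) :
    ∃ Ψ ∈ Submodule.span 𝕜 (Set.range L), ‖Φ - Ψ‖ ≤ ε := by
  let K : Submodule 𝕜 E := ⨅ i, (L i).ker
  have hK : ‖Φ.comp K.subtypeL‖ ≤ ε := ContinuousLinearMap.opNorm_le_of_unit_norm hε fun e he =>
    hΦ e he.le fun i => (Submodule.mem_iInf _).1 e.2 i
  obtain ⟨g, hgK, hg⟩ := exists_extension_norm_eq K (Φ.comp K.subtypeL)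
  have hspan : (Φ - g).toLinearMap ∈ Submodule.span 𝕜 (Set.range fun i => (L i).toLinearMap) :=
    mem_span_of_iInf_ker_le_ker fun e he =>
      sub_eq_zero.2 (hgK ⟨e, he⟩).symm
  rw [show (fun i => (L i).toLinearMap) = ContinuousLinearMap.coeLM 𝕜 ∘ L from rfl, Set.range_comp,
    Submodule.span_image] at hspan
  obtain ⟨Ψ, hΨ, hΨg⟩ := hspan
  obtain rfl : Ψ = Φ - g := ContinuousLinearMap.coe_injective hΨg
  exact ⟨Φ - g, hΨ, by rwa [sub_sub_cancel, hg]⟩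

theorem exists_finite_of_mem_dualBallNhds_zero {s : Set (StrongDual 𝕜 E)}
    (hs : s ∈ dualBallNhds (0 : StrongDual 𝕜 E)) :
    ∃ t : Set E, t.Finite ∧ ∀ y : StrongDual 𝕜 E, ‖y‖ ≤ 1 → (∀ e ∈ t, y e = 0) → y ∈ s := by
  let ball : Set (StrongDual 𝕜 E) := {y | ‖y‖ ≤ 1}
  let l : Filter (StrongDual 𝕜 E) := (⨅ e : E, 𝓟 {y | y e = 0}) ⊓ 𝓟 ball
  have hl : Tendsto id l (dualBallNhds 0) := by
    refine tendsto_dualBallNhds_iff.2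
      ⟨mem_inf_of_right (mem_principal_self _), fun e => tendsto_const_nhds.congr' ?_⟩
    have : ∀ᶠ y in l, y e = 0 := mem_inf_of_left (mem_iInf_of_mem e (mem_principal_self _))
    exact this.mono fun y hy => hy.symm
  obtain ⟨t, ht, hts⟩ := ((hasBasis_iInf_principal_finite _).inf_principal ball).mem_iff.1 (hl hs)
  exact ⟨t, ht, fun y hy hyt => hts ⟨Set.mem_iInter₂.2 hyt, hy⟩⟩

theorem mem_range_inclusionInDoubleDual_of_tendsto [CompleteSpace E]
    {Φ : StrongDual 𝕜 (StrongDual 𝕜 E)} (hΦ : Tendsto Φ (dualBallNhds 0) (𝓝 0)) :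
    Φ ∈ Set.range (NormedSpace.inclusionInDoubleDual 𝕜 E) := by
  have hiso : Isometry (NormedSpace.inclusionInDoubleDual 𝕜 E) :=
    (NormedSpace.inclusionInDoubleDualLi 𝕜 (E := E)).isometry
  rw [← hiso.isClosedEmbedding.isClosed_range.closure_eq, Metric.mem_closure_iff]
  intro ε hε
  obtain ⟨t, ht, hts⟩ :=
    exists_finite_of_mem_dualBallNhds_zero (hΦ (Metric.closedBall_mem_nhds 0 (half_pos hε)))
  have : Finite t := ht
  obtain ⟨Ψ, hΨ, hΦΨ⟩ :=
    exists_mem_span_norm_sub_le (fun e : t => NormedSpace.inclusionInDoubleDual 𝕜 E e)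
      (half_pos hε).le fun y hy hyt => mem_closedBall_zero_iff.1 (hts y hy fun e he => hyt ⟨e, he⟩)
  refine ⟨Ψ, ?_, (dist_eq_norm Φ Ψ).trans_lt (hΦΨ.trans_lt (half_lt_self hε))⟩
  have hspan : Submodule.span 𝕜 (Set.range fun e : t => NormedSpace.inclusionInDoubleDual 𝕜 E e) ≤
      (NormedSpace.inclusionInDoubleDual 𝕜 E).range :=
    Submodule.span_le.2 (Set.range_subset_iff.2 fun e => ⟨e, rfl⟩)
  exact hspan hΨ

theorem IsWeakStarWeakPC.norm_eq_one [CompleteSpace E] {x : StrongDual 𝕜 E}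
    (hx : IsWeakStarWeakPC x) (hE : ¬IsReflexiveSpace 𝕜 E) : ‖x‖ = 1 := by
  by_contra hne
  refine hE fun Φ => mem_range_inclusionInDoubleDual_of_tendsto ?_
  have hr : 0 < 1 - ‖x‖ := sub_pos.2 (hx.1.lt_of_ne hne)
  have hr𝕜 : ((1 - ‖x‖ : ℝ) : 𝕜) ≠ 0 := RCLike.ofReal_ne_zero.2 hr.ne'
  -- The dual ball contains a ball around `x`, so continuity at `x` carries over to `0`.
  have htranslate : Tendsto (fun y => x + ((1 - ‖x‖ : ℝ) : 𝕜) • y) (dualBallNhds 0)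
      (dualBallNhds x) := by
    refine tendsto_dualBallNhds_iff.2 ⟨?_, fun e => ?_⟩
    · filter_upwards [eventually_dualBallNhds_norm_le_one (0 : StrongDual 𝕜 E)] with y hy
      calc ‖x + ((1 - ‖x‖ : ℝ) : 𝕜) • y‖ ≤ ‖x‖ + (1 - ‖x‖) * ‖y‖ := by
            refine (norm_add_le _ _).trans_eq ?_
            rw [norm_smul, RCLike.norm_of_nonneg hr.le]
        _ ≤ 1 := by linarith [mul_le_of_le_one_right hr.le hy]
    · simpa using ((tendsto_apply_dualBallNhds (0 : StrongDual 𝕜 E) e).const_mul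
        ((1 - ‖x‖ : ℝ) : 𝕜)).const_add (x e)
  have hlim := ((hx.tendsto_apply htranslate Φ).sub_const (Φ x)).const_mul
    ((1 - ‖x‖ : ℝ) : 𝕜)⁻¹
  simpa only [map_add, map_smul, add_sub_cancel_left, smul_eq_mul, inv_mul_cancel_left₀ hr𝕜,
    sub_self, mul_zero] using hlim

end Nonreflexive

section Decomposition

variable {𝕜 E : Type*} [RCLike 𝕜] [NormedAddCommGroup E] [NormedSpace 𝕜 E] {ι : Type*}
  {P : ι → E →L[𝕜] E} {Λ : StrongDual 𝕜 E}

theorem tendsto_norm_comp_dualBallNhds (hP : ∀ i, IsMprojection E (P i))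
    (hPP : Pairwise fun i j => P i ∘L P j = 0) (hΛ : HasSum (fun i => ‖Λ ∘L P i‖) 1) (i : ι) :
    Tendsto (fun L : StrongDual 𝕜 E => ‖L ∘L P i‖) (dualBallNhds Λ) (𝓝 ‖Λ ∘L P i‖) := by
  refine tendsto_of_eventually_lt_of_sum_le (f := fun i (L : StrongDual 𝕜 E) => ‖L ∘L P i‖) hΛ
    (fun j b hb => eventually_lt_norm_of_tendsto_apply
      (fun e => tendsto_apply_dualBallNhds Λ (P j e)) hb) ?_ i
  filter_upwards [eventually_dualBallNhds_norm_le_one Λ] with L hL s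
  linarith [sum_norm_comp_add_norm_sub_sum_comp hP hPP s L,
    norm_nonneg (L - ∑ i ∈ s, L ∘L P i)]

theorem tendstoUniformlyOnFilter_sum_comp (hP : ∀ i, IsMprojection E (P i))
    (hPP : Pairwise fun i j => P i ∘L P j = 0) (hΛ : HasSum (fun i => ‖Λ ∘L P i‖) 1) :
    TendstoUniformlyOnFilter (fun (s : Finset ι) (L : StrongDual 𝕜 E) => ∑ i ∈ s, L ∘L P i) id
      atTop (dualBallNhds Λ) := by
  refine Metric.tendstoUniformlyOnFilter_iff.2 fun ε hε => ?_
  obtain ⟨s, hs⟩ := (hΛ.eventually_const_lt (sub_lt_self 1 hε)).exists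
  have hlim : Tendsto (fun L : StrongDual 𝕜 E => ∑ i ∈ s, ‖L ∘L P i‖) (dualBallNhds Λ)
      (𝓝 (∑ i ∈ s, ‖Λ ∘L P i‖)) :=
    tendsto_finsetSum s fun i _ => tendsto_norm_comp_dualBallNhds hP hPP hΛ i
  filter_upwards [prod_mem_prod (eventually_ge_atTop s)
    ((hlim.eventually_const_lt hs).and (eventually_dualBallNhds_norm_le_one Λ))]
    with ⟨t, L⟩ ⟨hst, hLs, hL⟩
  have hmono : ∑ i ∈ s, ‖L ∘L P i‖ ≤ ∑ i ∈ t, ‖L ∘L P i‖ :=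
    Finset.sum_le_sum_of_subset_of_nonneg hst fun i _ _ => norm_nonneg (L ∘L P i)
  rw [id, dist_eq_norm]
  linarith [sum_norm_comp_add_norm_sub_sum_comp hP hPP t L]

theorem isWeakStarWeakPC_of_hasSum_of_comp_eq (hP : ∀ i, IsMprojection E (P i))
    (hPP : Pairwise fun i j => P i ∘L P j = 0) {α : ι → ℝ} (hα : ∀ i, 0 < α i)
    (hsum : HasSum α 1) {ψ : ι → StrongDual 𝕜 E} (hψ : ∀ i, IsWeakStarWeakPC (ψ i))
    (hψ1 : ∀ i, ‖ψ i‖ = 1) (hψP : ∀ i, ψ i ∘L P i = ψ i)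
    (hΛ : HasSum (fun i => (α i : 𝕜) • ψ i) Λ) : IsWeakStarWeakPC Λ := by
  have hαψ : ∀ i, ‖(α i : 𝕜) • ψ i‖ = α i := fun i => by
    rw [norm_smul, hψ1, mul_one, RCLike.norm_of_nonneg (hα i).le]
  have hψP_ne : ∀ i j, j ≠ i → ψ j ∘L P i = 0 := fun i j hji => by
    rw [← hψP j, ContinuousLinearMap.comp_assoc, hPP hji, ContinuousLinearMap.comp_zero]
  have hΛP : ∀ i, Λ ∘L P i = (α i : 𝕜) • ψ i := fun i => by
    refine (hΛ.mapL ((P i).precomp 𝕜)).unique ?_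
    convert hasSum_single i fun j hj => ?_ using 1
    · exact (congrArg ((α i : 𝕜) • ·) (hψP i)).symm
    · exact (congrArg ((α j : 𝕜) • ·) (hψP_ne i j hj)).trans
        (smul_zero (A := StrongDual 𝕜 E) (α j : 𝕜))
  have hΛnorm : HasSum (fun i => ‖Λ ∘L P i‖) 1 := by simpa only [hΛP, hαψ] using hsum
  refine isWeakStarWeakPC_iff.2
    ⟨hΛ.norm_le_of_bounded hsum fun i => (hαψ i).le, fun Φ => ?_⟩
  have hcomp : ∀ i, Tendsto (fun L : StrongDual 𝕜 E => Φ (L ∘L P i)) (dualBallNhds Λ)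
      (𝓝 (Φ ((α i : 𝕜) • ψ i))) := fun i => by
    refine (hψ i).tendsto_apply_of_tendsto_norm (hα i) ?_ (fun e => ?_) Φ
    · simpa only [hΛP, hαψ] using tendsto_norm_comp_dualBallNhds hP hPP hΛnorm i
    · simpa only [← hΛP] using! tendsto_apply_dualBallNhds Λ (P i e)
  refine (Φ.uniformContinuous.comp_tendstoUniformlyOnFilter
    (tendstoUniformlyOnFilter_sum_comp hP hPP hΛnorm)).tendsto_of_eventually_tendsto
    (Eventually.of_forall fun s => ?_) ((Φ.continuous.tendsto Λ).comp hΛ)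
  simpa only [Function.comp_def, map_sum] using tendsto_finsetSum s fun i _ => hcomp i

end Decomposition

section Transfer

variable {𝕜 E X : Type*} [RCLike 𝕜] [NormedAddCommGroup E] [NormedSpace 𝕜 E]
  [NormedAddCommGroup X] [NormedSpace 𝕜 X] {J : X →ₗᵢ[𝕜] E} {Q : E →L[𝕜] X}

theorem norm_comp_eq_of_isMprojection (hQJ : ∀ e, Q (J e) = e)
    (hJQ : IsMprojection E (J.toContinuousLinearMap ∘L Q)) (x : StrongDual 𝕜 X) :
    ‖x ∘L Q‖ = ‖x‖ := by
  refine le_antisymm (ContinuousLinearMap.opNorm_le_bound _ (norm_nonneg x) fun f => ?_)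
    (ContinuousLinearMap.opNorm_le_bound _ (norm_nonneg _) fun e => ?_)
  · have hQf : ‖Q f‖ ≤ ‖f‖ := by
      rw [← J.norm_map]
      exact (le_max_left _ _).trans_eq (hJQ.Mnorm f).symm
    exact (x.le_opNorm _).trans (mul_le_mul_of_nonneg_left hQf (norm_nonneg x))
  · simpa only [ContinuousLinearMap.comp_apply, hQJ, J.norm_map] using (x ∘L Q).le_opNorm (J e)

theorem tendsto_norm_sub_comp_dualBallNhds {P : E →L[𝕜] E} (hP : IsMprojection E P)
    {Λ : StrongDual 𝕜 E} (hΛ : ‖Λ ∘L P‖ = 1) :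
    Tendsto (fun L : StrongDual 𝕜 E => L - L ∘L P) (dualBallNhds Λ) (𝓝 0) := by
  refine Metric.tendsto_nhds.2 fun ε hε => ?_
  filter_upwards [eventually_dualBallNhds_norm_le_one Λ,
    eventually_lt_norm_of_tendsto_apply (u := fun L : StrongDual 𝕜 E => L ∘L P) (x := Λ ∘L P)
      (fun e => tendsto_apply_dualBallNhds Λ (P e)) (hΛ.symm ▸ sub_lt_self 1 hε)] with L hL hLP
  have hsplit : ‖L‖ = ‖L ∘L P‖ + ‖L - L ∘L P‖ := (isLprojection_precomp hP).Lnorm L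
  rw [dist_zero_right]
  linarith

theorem IsWeakStarWeakPC.comp_of_isMprojection {x : StrongDual 𝕜 X} (hx : IsWeakStarWeakPC x)
    (hx1 : ‖x‖ = 1) (hQJ : ∀ e, Q (J e) = e)
    (hJQ : IsMprojection E (J.toContinuousLinearMap ∘L Q)) : IsWeakStarWeakPC (x ∘L Q) := by
  have hxQ : ‖x ∘L Q‖ = 1 := (norm_comp_eq_of_isMprojection hQJ hJQ x).trans hx1
  have hxQJ : (x ∘L Q) ∘L (J.toContinuousLinearMap ∘L Q) = x ∘L Q :=
    ContinuousLinearMap.ext fun f => congr(x $(hQJ (Q f)))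
  refine isWeakStarWeakPC_iff.2 ⟨hxQ.le, fun Φ => ?_⟩
  have hrestrict : Tendsto (fun L : StrongDual 𝕜 E => L ∘L J.toContinuousLinearMap)
      (dualBallNhds (x ∘L Q)) (dualBallNhds x) := by
    refine tendsto_dualBallNhds_iff.2 ⟨?_, fun e => ?_⟩
    · filter_upwards [eventually_dualBallNhds_norm_le_one (x ∘L Q)] with L hL
      exact (L.opNorm_comp_le _).trans
        (mul_le_one₀ hL (norm_nonneg _) J.norm_toContinuousLinearMap_le)
    · simpa [hQJ] using tendsto_apply_dualBallNhds (x ∘L Q) (J e)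
  have hmain := hx.tendsto_apply hrestrict (Φ ∘L Q.precomp 𝕜)
  have hrest := (Φ.continuous.tendsto 0).comp
    (tendsto_norm_sub_comp_dualBallNhds hJQ (hxQJ.symm ▸ hxQ))
  refine (by simpa using hmain.add hrest : Tendsto _ _ _).congr fun L => ?_
  rw [← ContinuousLinearMap.comp_assoc]
  exact add_sub_cancel _ _

end Transfer

namespace WC

variable {𝕜 Ω X : Type*} [RCLike 𝕜] [TopologicalSpace Ω] [NormedAddCommGroup X] [NormedSpace 𝕜 X]

/-- Evaluation at `ω`, so that `deltaTensor ω φ` is by definition `φ ∘L WC.eval ω`. -/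
noncomputable def eval (ω : Ω) : WC 𝕜 Ω X →L[𝕜] X :=
  (lp.evalCLM 𝕜 (fun _ : Ω => X) ∞ ω).comp (WC 𝕜 Ω X).subtypeL

theorem norm_eval_le (f : WC 𝕜 Ω X) (ω : Ω) : ‖eval ω f‖ ≤ ‖f‖ :=
  lp.norm_apply_le_norm ENNReal.top_ne_zero (f : lp (fun _ : Ω => X) ∞) ω

theorem norm_le_of_forall_eval_le {f : WC 𝕜 Ω X} {C : ℝ} (hC : 0 ≤ C)
    (hf : ∀ ω, ‖eval ω f‖ ≤ C) : ‖f‖ ≤ C :=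
  lp.norm_le_of_forall_le (f := (f : lp (fun _ : Ω => X) ∞)) hC hf

open Classical in
/-- For an isolated closed point `ω`, the embedding sending `e` to the function with value `e` at
`ω` and `0` elsewhere. -/
noncomputable def single {ω : Ω} (hω : IsClopen {ω}) : X →ₗᵢ[𝕜] WC 𝕜 Ω X where
  toLinearMap := (lp.lsingle (𝕜 := 𝕜) (E := fun _ : Ω => X) ∞ ω).codRestrict (WC 𝕜 Ω X) fun e => by
    have hlc : IsLocallyConstant (Pi.single ω e : Ω → X) := by
      refine (IsLocallyConstant.iff_exists_open _).2 fun η => ?_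
      by_cases hη : η = ω
      · exact ⟨{ω}, hω.isOpen, hη, fun y hy => congrArg _ (hy.trans hη.symm)⟩
      · exact ⟨{ω}ᶜ, hω.compl.isOpen, hη, fun y hy => by
          rw [Pi.single_eq_of_ne hη, Pi.single_eq_of_ne hy]⟩
    exact (hlc.comp (toWeakSpace 𝕜 X)).continuous
  norm_map' e := lp.norm_single (E := fun _ : Ω => X) ENNReal.zero_lt_top ω e

theorem eval_single_self {ω : Ω} (hω : IsClopen {ω}) (e : X) :
    eval ω (single (𝕜 := 𝕜) hω e) = e := by
  classical
  exact Pi.single_eq_same (M := fun _ : Ω => X) ω e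

theorem eval_single_of_ne {ω η : Ω} (hω : IsClopen {ω}) (hη : η ≠ ω) (e : X) :
    eval η (single (𝕜 := 𝕜) hω e) = 0 := by
  classical
  exact Pi.single_eq_of_ne (M := fun _ : Ω => X) hη e

theorem isMprojection_single_comp_eval {ω : Ω} (hω : IsClopen {ω}) :
    IsMprojection (WC 𝕜 Ω X) ((single (𝕜 := 𝕜) (X := X) hω).toContinuousLinearMap ∘L eval ω) := by
  let J : X →ₗᵢ[𝕜] WC 𝕜 Ω X := single hω
  refine ⟨ContinuousLinearMap.ext fun f => congrArg J (eval_single_self hω (eval ω f)), fun f => ?_⟩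
  change ‖f‖ = max ‖J (eval ω f)‖ ‖f - J (eval ω f)‖
  have heval_self : eval ω (f - J (eval ω f)) = 0 := by
    rw [map_sub, eval_single_self, sub_self]
  have heval_of_ne : ∀ η ≠ ω, eval η (f - J (eval ω f)) = eval η f := fun η hη => by
    rw [map_sub, eval_single_of_ne hω hη, sub_zero]
  rw [J.norm_map]
  refine le_antisymm (norm_le_of_forall_eval_le (by positivity) fun η => ?_)
    (max_le (norm_eval_le f ω) (norm_le_of_forall_eval_le (norm_nonneg f) fun η => ?_))
  · obtain rfl | hη := eq_or_ne η ω
    · exact le_max_left _ _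
    · exact le_max_of_le_right (heval_of_ne η hη ▸ norm_eval_le _ η)
  · obtain rfl | hη := eq_or_ne η ω
    · exact heval_self ▸ norm_zero.trans_le (norm_nonneg f)
    · exact heval_of_ne η hη ▸ norm_eval_le f η

end WC

theorem theorem4p2_general {𝕜 Ω X : Type*} [RCLike 𝕜] [TopologicalSpace Ω]
    [NormedAddCommGroup X] [NormedSpace 𝕜 X] [CompleteSpace X] {ι : Type*}
    (α : ι → ℝ) (hα : ∀ i, 0 < α i) (hsum : HasSum α 1)
    (ω : ι → Ω) (hω : Function.Injective ω) (hclopen : ∀ i, IsClopen {ω i})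
    (x : ι → StrongDual 𝕜 X) (hx : ∀ i, IsWeakStarWeakPC (x i))
    (hnorm : IsReflexiveSpace 𝕜 X → ∀ i, ‖x i‖ = 1)
    (Λ : StrongDual 𝕜 (WC 𝕜 Ω X))
    (hΛ : HasSum (fun i => (α i : 𝕜) • deltaTensor (ω i) (x i)) Λ) :
    IsWeakStarWeakPC Λ := by
  have hx1 : ∀ i, ‖x i‖ = 1 := fun i =>
    (em (IsReflexiveSpace 𝕜 X)).elim (hnorm · i) (hx i).norm_eq_one
  have hP := fun i => WC.isMprojection_single_comp_eval (𝕜 := 𝕜) (X := X) (hclopen i)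
  have hQJ := fun i => WC.eval_single_self (𝕜 := 𝕜) (X := X) (hclopen i)
  refine isWeakStarWeakPC_of_hasSum_of_comp_eq hP (fun i j hij => ?_) hα hsum
    (fun i => (hx i).comp_of_isMprojection (hx1 i) (hQJ i) (hP i))
    (fun i => (norm_comp_eq_of_isMprojection (hQJ i) (hP i) (x i)).trans (hx1 i))
    (fun i => ContinuousLinearMap.ext fun f => congrArg (x i) (hQJ i _)) hΛ
  ext1 f
  change WC.single (hclopen i) (WC.eval (ω i) (WC.single (hclopen j) (WC.eval (ω j) f))) = 0
  rw [WC.eval_single_of_ne (hclopen j) (hω.ne hij), map_zero]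

theorem theorem4p2 {𝕜 Ω X : Type*} [RCLike 𝕜]
    [TopologicalSpace Ω] [CompactSpace Ω] [T2Space Ω] [ExtremallyDisconnected Ω]
    [NormedAddCommGroup X] [NormedSpace 𝕜 X] [CompleteSpace X]
    {ι : Type*} [Countable ι]
    (α : ι → ℝ) (hα : ∀ i, α i ∈ Set.Ioc (0 : ℝ) 1) (hsum : HasSum α 1)
    (ω : ι → Ω) (hω : Function.Injective ω) (hisol : ∀ i, IsOpen ({ω i} : Set Ω))
    (x : ι → StrongDual 𝕜 X) (hx : ∀ i, IsWeakStarWeakPC (x i))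
    (hnorm : IsReflexiveSpace 𝕜 X → ∀ i, ‖x i‖ = 1)
    (Λ : StrongDual 𝕜 (WC 𝕜 Ω X))
    (hΛ : HasSum (fun i => (α i : 𝕜) • deltaTensor (ω i) (x i)) Λ) :
    IsWeakStarWeakPC Λ :=
  theorem4p2_general α (fun i => (hα i).1) hsum ω hω (fun i => ⟨isClosed_singleton, hisol i⟩)
    x hx hnorm Λ hΛ
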